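/- Let $A$ be an alphabet. If $X$ is a non-empty finite string over $A$ and $Y$ is a (possibly empty) prefix of $X$, then a string $Z=X\cdots XY$, with at least one copy of $X$ before $Y$, is called a fractional power of $X$, and $|Z|/|X|$ is its exponent. The critical exponent of an infinite sequence $\omega=\omega_0\omega_1\omega_2\ldots$ over $A$ is the least upper bound of the exponents of all fractional powers that are substrings (blocks of consecutive letters) of $\omega$. Theorem (Krieger–Shallit). For every real number $\alpha>1$ there exist a finite alphabet $A$ and an infinite sequence $\omega=\omega_0\omega_1\omega_2\ldots$ over $A$ whose critical exponent is exactly $\alpha$. -/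

import Mathlib

/-- `Z = X ⋯ X Y`, with at least one copy of the non-empty string `X`, followed by a
(possibly empty) prefix `Y` of `X`: the string `Z` is a fractional power of `X`. -/
def IsFractionalPower {A : Type*} (X Z : List A) : Prop :=
  X ≠ [] ∧ ∃ n : ℕ, 1 ≤ n ∧ ∃ Y : List A, Y <+: X ∧ Z = (List.replicate n X).flatten ++ Y

/-- The string `Z` is a substring of the infinite sequence `ω`, i.e. a block of consecutive
letters `ω i, ω (i + 1), …, ω (i + |Z| - 1)`. -/
def IsSubstringOf {A : Type*} (Z : List A) (ω : ℕ → A) : Prop :=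
  ∃ i : ℕ, Z = (List.range Z.length).map (fun j => ω (i + j))

/-- The exponents `|Z| / |X|` of all fractional powers `Z` (of some `X`) that are
substrings of `ω`. -/
def powerExponents {A : Type*} (ω : ℕ → A) : Set ℝ :=
  {e | ∃ X Z : List A, IsFractionalPower X Z ∧ IsSubstringOf Z ω ∧
    e = (Z.length : ℝ) / (X.length : ℝ)}

/-- `α` is the critical exponent of `ω`: the least upper bound of the exponents of all
fractional powers that are substrings of `ω`. -/
def HasCriticalExponent {A : Type*} (ω : ℕ → A) (α : ℝ) : Prop :=
  IsLUB (powerExponents ω) α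

/-! ### Fractional powers as periodic blocks -/

section Periodicity

variable {A : Type*}

/-! Into a word whose own repetitions have exponent near 1, plant blocks of period P = 2^(n+2+i) and
length ⌊αP⌋; their exponents tend to α without exceeding it. The background letter records t and its
odd part modulo 2^(n+2). If windows of length l at distance p agree and 2^e exactly divides p, a
position of 2-adic valuation e-n-1 in the window would force 2^(e+1) ∣ p; hence 2^n l ≤ p
(`pow_mul_length_le`). Inside a block t is reduced modulo P, which preserves this argument unless P
∣ p; a repetition within the block then has exponent at most α. Blocks are flagged and sparse, so
every other repetition has 2^n l ≤ 2p (`HasPeriodAt.pow_mul_length_le_or`) and exponent at most 1 +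
2^(1-n) ≤ α. -/

/-- The block of length `L` of `ω` starting at position `s`. -/
def factorAt (ω : ℕ → A) (s L : ℕ) : List A :=
  (List.range L).map (fun j => ω (s + j))

@[simp] lemma length_factorAt (ω : ℕ → A) (s L : ℕ) : (factorAt ω s L).length = L := by
  simp [factorAt]

lemma factorAt_add (ω : ℕ → A) (s K L : ℕ) :
    factorAt ω s (K + L) = factorAt ω s K ++ factorAt ω (s + K) L := by
  simp [factorAt, List.range_add, Function.comp_def, add_assoc]

lemma isSubstringOf_factorAt (ω : ℕ → A) (s L : ℕ) : IsSubstringOf (factorAt ω s L) ω :=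
  ⟨s, by rw [length_factorAt]; rfl⟩

/-- The block of length `L` at position `s` of `ω` has period `p`. -/
def HasPeriodAt (ω : ℕ → A) (s p L : ℕ) : Prop :=
  ∀ j, j + p < L → ω (s + j) = ω (s + p + j)

lemma IsFractionalPower.getElem?_add {X Z : List A} (h : IsFractionalPower X Z) {j : ℕ}
    (hj : j + X.length < Z.length) : Z[j + X.length]? = Z[j]? := by
  obtain ⟨-, n, hn, Y, hY, rfl⟩ := h
  obtain ⟨n, rfl⟩ : ∃ k, n = k + 1 := ⟨n - 1, by omega⟩
  set T := (List.replicate n X).flatten ++ Y with hT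
  have hZ : (List.replicate (n + 1) X).flatten ++ Y = X ++ T := by
    simp [hT, List.replicate_succ]
  have hpre : T <+: X ++ T := by
    rw [← hZ, List.replicate_succ', List.flatten_append, hT, List.append_assoc]
    refine (List.prefix_append_right_inj _).2 ?_
    simpa using hY.trans (List.prefix_append X Y)
  rw [hZ] at hj ⊢
  have hjT : j < T.length := by simp at hj; omega
  obtain ⟨R, hR⟩ := hpre
  rw [List.getElem?_append_right (by omega), Nat.add_sub_cancel, ← hR,
    List.getElem?_append_left hjT]

lemma isFractionalPower_factorAt {ω : ℕ → A} {p : ℕ} (hp : 0 < p) (L : ℕ) :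
    ∀ s, p ≤ L → HasPeriodAt ω s p L →
      IsFractionalPower (factorAt ω s p) (factorAt ω s L) := by
  induction L using Nat.strong_induction_on with
  | _ L ih =>
    intro s hL hper
    have hne : ∀ s, factorAt ω s p ≠ [] := fun s h => by
      have := congrArg List.length h
      simp at this
      omega
    obtain ⟨K, rfl⟩ := Nat.exists_eq_add_of_le hL
    have hshift : ∀ M, M ≤ K → factorAt ω (s + p) M = factorAt ω s M := by
      intro M hM
      refine List.map_congr_left fun j hj => (hper j ?_).symm
      have := List.mem_range.1 hj
      omega
    rw [factorAt_add]
    rcases lt_or_ge K p with hK | hK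
    · refine ⟨hne s, 1, le_rfl, factorAt ω s K, ?_, ?_⟩
      · obtain ⟨R, rfl⟩ := Nat.exists_eq_add_of_le hK.le
        rw [factorAt_add]
        exact List.prefix_append _ _
      · simp [hshift K le_rfl]
    · obtain ⟨-, n, -, Y, hY, hZ⟩ := ih K (by omega) (s + p) hK fun j hj => by
        have := hper (p + j) (by omega)
        simpa [add_assoc] using this
      rw [hshift p hK] at hY hZ
      exact ⟨hne s, n + 1, by omega, Y, hY, by rw [hZ]; simp [List.replicate_succ]⟩

lemma mem_powerExponents_iff {ω : ℕ → A} {e : ℝ} :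
    e ∈ powerExponents ω ↔ ∃ s p L : ℕ, 0 < p ∧ p ≤ L ∧ HasPeriodAt ω s p L ∧
      e = (L : ℝ) / (p : ℝ) := by
  constructor
  · rintro ⟨X, Z, hXZ, ⟨s, hs⟩, rfl⟩
    refine ⟨s, X.length, Z.length, List.length_pos_iff.2 hXZ.1, ?_, ?_, rfl⟩
    · obtain ⟨-, n, hn, Y, -, rfl⟩ := hXZ
      simp
      nlinarith
    · intro j hj
      have h := hXZ.getElem?_add hj
      rw [hs] at h
      simp only [List.getElem?_map] at h
      rw [List.getElem?_range hj, List.getElem?_range (by omega)] at h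
      simpa [add_assoc, add_comm, add_left_comm, eq_comm] using h
  · rintro ⟨s, p, L, hp, hL, hper, rfl⟩
    exact ⟨factorAt ω s p, factorAt ω s L, isFractionalPower_factorAt hp L s hL hper,
      isSubstringOf_factorAt ω s L, by simp⟩

lemma powerExponents_comp {B : Type*} {f : A → B} (hf : Function.Injective f) (ω : ℕ → A) :
    powerExponents (f ∘ ω) = powerExponents ω := by
  ext e
  simp [mem_powerExponents_iff, HasPeriodAt, hf.eq_iff]

end Periodicity

/-! ### Odd parts and 2-adic rigidity -/

section OddPart

/-- The odd part of a natural number. -/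
def oddPart (t : ℕ) : ℕ := t / 2 ^ padicValNat 2 t

lemma pow_mul_oddPart {f x : ℕ} (hx : x ≡ 2 ^ f [MOD 2 ^ (f + 1)]) : x = 2 ^ f * oddPart x := by
  have h2 : (2 : ℕ) ^ f < 2 ^ (f + 1) := Nat.pow_lt_pow_right (by norm_num) (by omega)
  have hdvd : 2 ^ f ∣ x := (hx.dvd_iff (pow_dvd_pow 2 (Nat.le_succ f))).2 dvd_rfl
  have hndvd : ¬ 2 ^ (f + 1) ∣ x := fun h =>
    absurd (Nat.le_of_dvd (by positivity) ((hx.dvd_iff dvd_rfl).1 h)) (by omega)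
  have hx0 : x ≠ 0 := by rintro rfl; simp at hndvd
  have hv : padicValNat 2 x = f := by
    apply le_antisymm
    · by_contra! h
      exact hndvd ((padicValNat_dvd_iff_le hx0).2 h)
    · exact (padicValNat_dvd_iff_le hx0).1 hdvd
  rw [oddPart, hv, Nat.mul_div_cancel' hdvd]

lemma modEq_of_oddPart_modEq {f c x y : ℕ} (hx : x ≡ 2 ^ f [MOD 2 ^ (f + 1)])
    (hy : y ≡ 2 ^ f [MOD 2 ^ (f + 1)]) (h : oddPart x ≡ oddPart y [MOD 2 ^ c]) :
    x ≡ y [MOD 2 ^ (f + c)] := by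
  rw [pow_mul_oddPart hx, pow_mul_oddPart hy, pow_add]
  exact Nat.ModEq.mul_left' _ h

lemma exists_add_modEq (N s r : ℕ) (hN : 0 < N) : ∃ j < N, s + j ≡ r [MOD N] := by
  refine ⟨(r + (N - s % N)) % N, Nat.mod_lt _ hN, ?_⟩
  have h1 : s % N < N := Nat.mod_lt _ hN
  calc s + (r + (N - s % N)) % N ≡ s % N + (r + (N - s % N)) [MOD N] :=
        (Nat.mod_modEq s N).symm.add (Nat.mod_modEq _ N)
    _ = r + N := by omega
    _ ≡ r [MOD N] := by simp [Nat.ModEq]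

/-- Two windows at distance `p` of a sequence recording `t` and the odd part of `t` modulo
`2 ^ (n + 2)` agree only if they are short, compared to `p`. Here `t` may be replaced by
any `φ t` that agrees with it to sufficient 2-adic precision. -/
lemma pow_mul_length_le {n s p l : ℕ} {φ : ℕ → ℕ} (hp : 0 < p)
    (h₁ : ∀ j < l, φ (s + j) ≡ s + j [MOD 2 ^ (padicValNat 2 p + 1)])
    (h₂ : ∀ j < l, φ (s + p + j) ≡ s + p + j [MOD 2 ^ (padicValNat 2 p + 1)])
    (hmod : ∀ j < l, s + j ≡ s + p + j [MOD 2 ^ (n + 2)])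
    (hodd : ∀ j < l, oddPart (φ (s + j)) ≡ oddPart (φ (s + p + j)) [MOD 2 ^ (n + 2)]) :
    2 ^ n * l ≤ p := by
  set e := padicValNat 2 p with he
  have shift : ∀ j M, s + j ≡ s + p + j [MOD M] → M ∣ p := by
    intro j M h
    have := (Nat.modEq_iff_dvd' (by omega)).1 h
    rwa [show s + p + j - (s + j) = p by omega] at this
  have hep : 2 ^ e ∣ p := (padicValNat_dvd_iff_le hp.ne').2 le_rfl
  have hnd : ¬ 2 ^ (e + 1) ∣ p := fun h => by
    have := (padicValNat_dvd_iff_le hp.ne').1 h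
    omega
  rcases Nat.eq_zero_or_pos l with rfl | hl
  · simp
  have hne : n + 2 ≤ e := (padicValNat_dvd_iff_le hp.ne').1 (shift 0 _ (hmod 0 hl))
  obtain ⟨k, hk⟩ := Nat.exists_eq_add_of_le hne
  have hlt : l < 2 ^ (k + 2) := by
    by_contra! hle
    -- Valuation k + 1 is chosen so that n + 2 bits of the odd part determine the position modulo
    -- 2^(e+1), one bit more than p allows.
    obtain ⟨j, hj, hjmod⟩ := exists_add_modEq (2 ^ (k + 1 + 1)) s (2 ^ (k + 1)) (by positivity)
    have hjl : j < l := lt_of_lt_of_le hj hle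
    have hdvd : 2 ^ (k + 1 + 1) ∣ 2 ^ (e + 1) := pow_dvd_pow 2 (by omega)
    have hp' : 2 ^ (k + 1 + 1) ∣ p := (pow_dvd_pow 2 (by omega)).trans hep
    have hx := ((h₁ j hjl).of_dvd hdvd).trans hjmod
    have hsp : s + p + j ≡ s + j [MOD 2 ^ (k + 1 + 1)] := by
      have := (Nat.modEq_zero_iff_dvd.2 hp').add_left (s + j)
      rwa [add_zero, show s + j + p = s + p + j by ring] at this
    have hy := ((h₂ j hjl).of_dvd hdvd).trans (hsp.trans hjmod)
    have hxy := modEq_of_oddPart_modEq hx hy (hodd j hjl)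
    rw [show k + 1 + (n + 2) = e + 1 by omega] at hxy
    exact hnd (shift j _ (((h₁ j hjl).symm.trans hxy).trans (h₂ j hjl)))
  calc 2 ^ n * l ≤ 2 ^ n * 2 ^ (k + 2) := Nat.mul_le_mul_left _ hlt.le
    _ = 2 ^ e := by rw [hk, ← pow_add]; congr 1; omega
    _ ≤ p := Nat.le_of_dvd hp hep

end OddPart

/-! ### The word with planted blocks -/

section PlantedWord

variable (α : ℝ) (n : ℕ)

/-- The length of the `i`-th planted block, whose period is `2 ^ (n + 2 + i)`. -/
noncomputable def blockLength (i : ℕ) : ℕ := ⌊α * 2 ^ (n + 2 + i)⌋₊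

/-- The first position of the `i`-th planted block. -/
noncomputable def blockStart : ℕ → ℕ
  | 0 => 0
  | i + 1 => (2 ^ n + 1) * (blockStart i + blockLength α n i)

/-- Position `t` lies in the `i`-th planted block. -/
def InBlock (i t : ℕ) : Prop :=
  blockStart α n i ≤ t ∧ t < blockStart α n i + blockLength α n i

open Classical in
/-- Reduction of positions in the `i`-th planted block modulo its period. -/
noncomputable def foldedIndex (t : ℕ) : ℕ :=
  if h : ∃ i, InBlock α n i t then t % 2 ^ (n + 2 + h.choose) else t

open Classical in
/-- A sequence in which all repetitions of large exponent are inside planted blocks. -/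
noncomputable def plantedWord (t : ℕ) : Bool × ZMod (2 ^ (n + 2)) × ZMod (2 ^ (n + 2)) :=
  (decide (∃ i, InBlock α n i t), (t : ZMod (2 ^ (n + 2))),
    (oddPart (foldedIndex α n t) : ZMod (2 ^ (n + 2))))

variable {α n}

lemma mul_blockEnd_le_blockStart {i j : ℕ} (h : i < j) :
    (2 ^ n + 1) * (blockStart α n i + blockLength α n i) ≤ blockStart α n j := by
  have hmono : Monotone (blockStart α n) := by
    refine monotone_nat_of_le_succ fun k => ?_
    rw [blockStart]
    nlinarith [Nat.zero_le (2 ^ n * (blockStart α n k + blockLength α n k))]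
  exact hmono (Nat.succ_le_of_lt h)

lemma InBlock.le_of_le {i j s t : ℕ} (hs : InBlock α n i s) (ht : InBlock α n j t)
    (h : s ≤ t) : i ≤ j := by
  by_contra! hij
  have := mul_blockEnd_le_blockStart (α := α) (n := n) hij
  have h1 := hs.1
  have h2 := ht.2
  nlinarith [Nat.zero_le (2 ^ n * (blockStart α n j + blockLength α n j))]

lemma foldedIndex_of_inBlock {i t : ℕ} (h : InBlock α n i t) :
    foldedIndex α n t = t % 2 ^ (n + 2 + i) := by
  have hex : ∃ i, InBlock α n i t := ⟨i, h⟩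
  have hi : hex.choose = i :=
    le_antisymm (hex.choose_spec.le_of_le h le_rfl) (h.le_of_le hex.choose_spec le_rfl)
  rw [foldedIndex, dif_pos hex, hi]

lemma foldedIndex_of_not_inBlock {t : ℕ} (h : ¬ ∃ i, InBlock α n i t) :
    foldedIndex α n t = t := dif_neg h

lemma plantedWord_eq_iff {s t : ℕ} : plantedWord α n s = plantedWord α n t ↔
    ((∃ i, InBlock α n i s) ↔ ∃ i, InBlock α n i t) ∧ s ≡ t [MOD 2 ^ (n + 2)] ∧
      oddPart (foldedIndex α n s) ≡ oddPart (foldedIndex α n t) [MOD 2 ^ (n + 2)] := by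
  simp only [plantedWord, Prod.mk.injEq, decide_eq_decide, ZMod.natCast_eq_natCast_iff]

lemma hasPeriodAt_plantedWord (i : ℕ) :
    HasPeriodAt (plantedWord α n) (blockStart α n i) (2 ^ (n + 2 + i)) (blockLength α n i) := by
  intro j hj
  generalize hP : 2 ^ (n + 2 + i) = P at hj
  have h₁ : InBlock α n i (blockStart α n i + j) := ⟨by omega, by omega⟩
  have h₂ : InBlock α n i (blockStart α n i + P + j) := ⟨by omega, by omega⟩
  have h : blockStart α n i + j ≡ blockStart α n i + P + j [MOD 2 ^ (n + 2 + i)] := by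
    rw [hP, add_right_comm _ P]
    simp [Nat.ModEq]
  refine plantedWord_eq_iff.2 ⟨⟨fun _ => ⟨i, h₂⟩, fun _ => ⟨i, h₁⟩⟩,
    h.of_dvd (pow_dvd_pow 2 (by omega)), ?_⟩
  rw [foldedIndex_of_inBlock h₁, foldedIndex_of_inBlock h₂, h]

lemma pow_mul_length_le_of_forall_not_inBlock {s p l : ℕ} (hp : 0 < p)
    (h : ∀ j < l, plantedWord α n (s + j) = plantedWord α n (s + p + j))
    (h0 : ∀ j < l, ¬ ∃ i, InBlock α n i (s + j)) : 2 ^ n * l ≤ p := by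
  refine pow_mul_length_le (s := s) (φ := foldedIndex α n) hp (fun j hj => ?_) (fun j hj => ?_)
    (fun j hj => (plantedWord_eq_iff.1 (h j hj)).2.1)
    (fun j hj => (plantedWord_eq_iff.1 (h j hj)).2.2)
  · rw [foldedIndex_of_not_inBlock (h0 j hj)]
  · rw [foldedIndex_of_not_inBlock
      (mt (plantedWord_eq_iff.1 (h j hj)).1.2 (h0 j hj))]

/-- If the block's period does not divide p, folding retains the `padicValNat 2 p + 1` low bits that
the rigidity estimate needs. -/
lemma dvd_or_pow_mul_length_le_of_forall_inBlock {i s p l : ℕ} (hp : 0 < p)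
    (h : ∀ j < l, plantedWord α n (s + j) = plantedWord α n (s + p + j))
    (h₁ : ∀ j < l, InBlock α n i (s + j)) (h₂ : ∀ j < l, InBlock α n i (s + p + j)) :
    2 ^ (n + 2 + i) ∣ p ∨ 2 ^ n * l ≤ p := by
  refine or_iff_not_imp_left.2 fun hdvd => ?_
  rw [padicValNat_dvd_iff_le hp.ne', not_le] at hdvd
  have hpow : 2 ^ (padicValNat 2 p + 1) ∣ 2 ^ (n + 2 + i) := pow_dvd_pow 2 hdvd
  refine pow_mul_length_le (s := s) (φ := foldedIndex α n) hp (fun j hj => ?_) (fun j hj => ?_)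
    (fun j hj => (plantedWord_eq_iff.1 (h j hj)).2.1)
    (fun j hj => (plantedWord_eq_iff.1 (h j hj)).2.2)
  · rw [foldedIndex_of_inBlock (h₁ j hj)]
    exact (Nat.mod_modEq _ _).of_dvd hpow
  · rw [foldedIndex_of_inBlock (h₂ j hj)]
    exact (Nat.mod_modEq _ _).of_dvd hpow

/-- If two equal windows both end inside the `i`-th block, they are contained in it. -/
lemma forall_inBlock_of_last {i s p l : ℕ} (hp : 0 < p)
    (h : ∀ j < l + 1, plantedWord α n (s + j) = plantedWord α n (s + p + j))
    (h₁ : InBlock α n i (s + l)) (h₂ : InBlock α n i (s + p + l)) :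
    ∀ j < l + 1, InBlock α n i (s + j) ∧ InBlock α n i (s + p + j) := by
  have hs : blockStart α n i ≤ s := by
    by_contra! hlt
    obtain ⟨h1, h2⟩ := h₁
    obtain ⟨h3, h4⟩ := h₂
    -- The position just before the block is matched with one inside it, so the flag puts it in an
    -- earlier block, contradicting the gap.
    set j := blockStart α n i - 1 - s with hj
    have hin : InBlock α n i (s + p + j) := ⟨by omega, by omega⟩
    obtain ⟨k, hk⟩ := (plantedWord_eq_iff.1 (h j (by omega))).1.2 ⟨i, hin⟩
    have hki : k ≤ i := hk.le_of_le ⟨h1, h2⟩ (by omega)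
    rcases hki.eq_or_lt with rfl | hki
    · have := hk.1
      omega
    · have := mul_blockEnd_le_blockStart (α := α) (n := n) hki
      have := hk.2
      nlinarith [Nat.zero_lt_of_lt hk.2, Nat.one_le_two_pow (n := n),
        show blockStart α n i ≤ s + j + 1 by omega]
  intro j hj
  have h2 := h₁.2
  have h4 := h₂.2
  exact ⟨⟨by omega, by omega⟩, ⟨by omega, by omega⟩⟩

/-- Equal windows ending in different blocks are short, compared to their distance. -/
lemma pow_mul_length_le_of_lt {i k s p j : ℕ} (hik : i < k)
    (h₁ : InBlock α n i (s + j)) (h₂ : InBlock α n k (s + p + j)) :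
    2 ^ n * (j + 1) ≤ p := by
  have h := mul_blockEnd_le_blockStart (α := α) (n := n) hik
  have h1 := h₁.2
  have h2 := h₂.1
  set b := blockStart α n i + blockLength α n i
  have h3 : 2 ^ n * (j + 1) ≤ 2 ^ n * b := Nat.mul_le_mul_left _ (by omega)
  rw [add_mul, one_mul] at h
  omega

/-- A repetition in `plantedWord` either has a small exponent, or is contained in a planted
block and has a period that is a multiple of the period of the block. -/
lemma HasPeriodAt.pow_mul_length_le_or {s p l : ℕ} (hp : 0 < p)
    (h : HasPeriodAt (plantedWord α n) s p (l + p)) :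
    2 ^ n * l ≤ 2 * p ∨ ∃ i, 2 ^ (n + 2 + i) ∣ p ∧ l + p ≤ blockLength α n i := by
  classical
  have h' : ∀ j < l, plantedWord α n (s + j) = plantedWord α n (s + p + j) :=
    fun j hj => h j (by omega)
  by_cases h0 : ∀ j < l, ¬ ∃ i, InBlock α n i (s + j)
  · left
    have := pow_mul_length_le_of_forall_not_inBlock hp h' h0
    omega
  push Not at h0
  obtain ⟨j₀, hj₀, hin₀⟩ := h0
  -- split the window after its last position in a block
  obtain ⟨j, hj, hin, hlast⟩ : ∃ j < l, (∃ i, InBlock α n i (s + j)) ∧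
      ∀ j' < l, j < j' → ¬ ∃ i, InBlock α n i (s + j') := by
    obtain ⟨j, hj, hmax⟩ := ((Finset.range l).filter
      fun j => ∃ i, InBlock α n i (s + j)).exists_max_image id ⟨j₀, by simp [hj₀, hin₀]⟩
    rw [Finset.mem_filter, Finset.mem_range] at hj
    refine ⟨j, hj.1, hj.2, fun j' hj' hlt hin' => ?_⟩
    have := hmax j' (by simp [hj', hin'])
    exact absurd this (not_le.2 hlt)
  obtain ⟨i, hi⟩ := hin
  obtain ⟨k, hk⟩ := (plantedWord_eq_iff.1 (h' j hj)).1.1 ⟨i, hi⟩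
  rcases (hi.le_of_le hk (by omega)).lt_or_eq with hik | rfl
  · left
    have hleft := pow_mul_length_le_of_lt hik hi hk
    have hright : 2 ^ n * (l - (j + 1)) ≤ p :=
      pow_mul_length_le_of_forall_not_inBlock (α := α) (s := s + (j + 1)) hp
        (fun j' hj' => by
          have := h' (j + 1 + j') (by omega)
          rwa [show s + (j + 1 + j') = s + (j + 1) + j' by ring,
            show s + p + (j + 1 + j') = s + (j + 1) + p + j' by ring] at this)
        (fun j' hj' => by
          rw [add_assoc]
          exact hlast _ (by omega) (by omega))
    obtain ⟨r, rfl⟩ := Nat.exists_eq_add_of_le (Nat.succ_le_of_lt hj)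
    rw [Nat.succ_eq_add_one, Nat.add_sub_cancel_left] at hright
    rw [Nat.succ_eq_add_one, mul_add]
    omega
  -- Otherwise the flag makes both windows leave block i right after offset j, though distinct
  -- positions cannot both be its last.
  · have hjl : l = j + 1 := by
      by_contra hne
      have hout := hlast (j + 1) (by omega) (by omega)
      have hout' := mt (plantedWord_eq_iff.1 (h' (j + 1) (by omega))).1.2 hout
      have h1 : ¬ InBlock α n i (s + (j + 1)) := fun hh => hout ⟨i, hh⟩
      have h2 : ¬ InBlock α n i (s + p + (j + 1)) := fun hh => hout' ⟨i, hh⟩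
      unfold InBlock at h1 h2 hi hk
      omega
    subst hjl
    have hall := forall_inBlock_of_last hp h' hi hk
    rcases dvd_or_pow_mul_length_le_of_forall_inBlock hp h' (fun j hj => (hall j hj).1)
      (fun j hj => (hall j hj).2) with hd | hd
    · refine Or.inr ⟨i, hd, ?_⟩
      have h1 := (hall 0 (by omega)).1.1
      have h2 := hk.2
      omega
    · left
      omega

lemma hasCriticalExponent_plantedWord (hα : 1 < α) (hn : 2 ≤ 2 ^ n * (α - 1)) :
    HasCriticalExponent (plantedWord α n) α := by
  constructor
  · intro e he
    obtain ⟨s, p, L, hp, hL, hper, rfl⟩ := mem_powerExponents_iff.1 he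
    obtain ⟨l, rfl⟩ := Nat.exists_eq_add_of_le' hL
    have hp' : (0 : ℝ) < p := by exact_mod_cast hp
    rw [div_le_iff₀ hp']
    rcases hper.pow_mul_length_le_or hp with h | ⟨i, hd, hle⟩
    · have h' : (2 : ℝ) ^ n * l ≤ 2 * p := by exact_mod_cast h
      have h2 : (0 : ℝ) < 2 ^ n := by positivity
      have : (2 : ℝ) ^ n * l ≤ 2 ^ n * ((α - 1) * p) := by nlinarith
      have := le_of_mul_le_mul_left this h2
      push_cast
      linarith
    · have hdp : (2 : ℝ) ^ (n + 2 + i) ≤ p := by exact_mod_cast Nat.le_of_dvd hp hd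
      calc ((l + p : ℕ) : ℝ) ≤ blockLength α n i := by exact_mod_cast hle
        _ ≤ α * 2 ^ (n + 2 + i) := Nat.floor_le (by positivity)
        _ ≤ α * p := by gcongr
  · intro B hB
    have key : ∀ i : ℕ, α ≤ B + (1 / 2) ^ i := by
      intro i
      set P : ℝ := 2 ^ (n + 2 + i) with hP
      have hP0 : 0 < P := by positivity
      have hPle : 2 ^ (n + 2 + i) ≤ blockLength α n i := by
        apply Nat.le_floor
        push_cast
        nlinarith
      have hmem : (blockLength α n i : ℝ) / P ∈ powerExponents (plantedWord α n) :=
        mem_powerExponents_iff.2 ⟨_, 2 ^ (n + 2 + i), _, by positivity, hPle,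
          hasPeriodAt_plantedWord i, by rw [hP]; push_cast; rfl⟩
      have hlt : α * P < blockLength α n i + 1 := Nat.lt_floor_add_one _
      have h1 : α ≤ blockLength α n i / P + 1 / P := by
        rw [← add_div, le_div_iff₀ hP0]
        exact hlt.le
      have h2 : 1 / P ≤ (1 / 2) ^ i := by
        rw [one_div_pow]
        exact one_div_le_one_div_of_le (by positivity)
          (pow_le_pow_right₀ (by norm_num) (by omega))
      linarith [hB hmem]
    have hlim : Filter.Tendsto (fun i : ℕ => B + (1 / 2 : ℝ) ^ i) Filter.atTop (nhds (B + 0)) :=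
      (tendsto_pow_atTop_nhds_zero_of_lt_one (by norm_num) (by norm_num)).const_add B
    rw [add_zero] at hlim
    exact ge_of_tendsto' hlim key

end PlantedWord

theorem theorem5 (α : ℝ) (hα : 1 < α) :
    ∃ (k : ℕ) (ω : ℕ → Fin k), HasCriticalExponent ω α := by
  -- This n makes the bound 1 + 2/2^n on unplanned exponents at most α.
  obtain ⟨n, hn⟩ := pow_unbounded_of_one_lt (2 / (α - 1)) (one_lt_two (α := ℝ))
  rw [div_lt_iff₀ (by linarith)] at hn
  let f := Fintype.equivFin (Bool × ZMod (2 ^ (n + 2)) × ZMod (2 ^ (n + 2)))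
  refine ⟨_, f ∘ plantedWord α n, ?_⟩
  rw [HasCriticalExponent, powerExponents_comp f.injective]
  exact hasCriticalExponent_plantedWord hα hn.le
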